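/- Let $\mathbb D=\{z\in\mathbb C:|z|<1\}$, let $\mathcal H_0$ be the set of analytic functions $f:\mathbb D\to\mathbb D$ with $f(0)=0$, and for $a\in\mathbb D$ let $T_a(z)=\dfrac{z+a}{1+\overline a z}$. Let $0\le s<r<1$ be real and let $\lambda,\mu\in\overline{\mathbb D}$. Put $$w_1=\frac sr+\frac{r^2-s^2}{r(1-r^2)}\lambda,\qquad w_2=\frac{2(r^2-s^2)}{r^2(1-r^2)^2}\bigl(\lambda(1-s\lambda)+r(1-|\lambda|^2)\mu\bigr),$$ $$A=\frac{6(r^2-s^2)}{r^3(1-r^2)^3},\qquad B=s^2\lambda^3-s(1+r^2)\lambda^2+r^2\lambda,$$ $$c_0=A\bigl(B+r\mu(1-|\lambda|^2)(1+r^2-2s\lambda-r\overline\lambda\mu)\bigr),\qquad \rho_0=Ar^2(1-|\lambda|^2)(1-|\mu|^2),$$ and let $u_0=s/r$. Let $\mathcal F$ be the set of all $f\in\mathcal H_0$ with $f(r)=s$, $f'(r)=w_1$ and $f''(r)=w_2$. (1) If $|\lambda|=1$, then $\mathcal F$ consists of exactly one function, $f(z)=z\,T_{u_0}\bigl(\lambda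 T_{-r}(z)\bigr)$, and $f'''(r)=c_0$. (2) If $|\lambda|<1$ and $|\mu|=1$, then $\mathcal F$ consists of exactly one function, $f(z)=z\,T_{u_0}\bigl(T_{-r}(z)\,T_\lambda(\mu T_{-r}(z))\bigr)$, and $f'''(r)=c_0$. (3) If $|\lambda|<1$ and $|\mu|<1$, then $\{f'''(r):f\in\mathcal F\}$ is the closed disk $\{\zeta\in\mathbb C:|\zeta-c_0|\le\rho_0\}$. Furthermore, for every $\theta\in\mathbb R$ the function $$f_\theta(z)=z\,T_{u_0}\Bigl(T_{-r}(z)\,T_\lambda\bigl(T_{-r}(z)\,T_\mu(e^{i\theta}T_{-r}(z))\bigr)\Bigr)$$ belongs to $\mathcal F$, and a function $f\in\mathcal F$ satisfies $|f'''(r)-c_0|=\rho_0$ if and only if $f=f_\theta$ for some $\theta\in\mathbb R$. -/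

import Mathlib

open Metric Set

namespace ThirdDieudonne

/-- The class `H₀` of analytic self-maps of the open unit disk fixing the origin. Only the values
of `f` on the disk matter: `f` is an arbitrary function outside of it. -/
def H0 : Set (ℂ → ℂ) :=
  {f | DifferentiableOn ℂ f (ball 0 1) ∧ MapsTo f (ball 0 1) (ball 0 1) ∧ f 0 = 0}

/-- The Möbius transformation `T_a(z) = (z + a) / (1 + conj a * z)`. -/
noncomputable def T (a z : ℂ) : ℂ :=
  (z + a) / (1 + (starRingEnd ℂ) a * z)

/-- The prescribed value of the first derivative at `r`. -/
noncomputable def w1 (r s : ℝ) (lam : ℂ) : ℂ :=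
  (s : ℂ) / r + ((r : ℂ) ^ 2 - (s : ℂ) ^ 2) / (r * (1 - (r : ℂ) ^ 2)) * lam

/-- The prescribed value of the second derivative at `r`. -/
noncomputable def w2 (r s : ℝ) (lam mu : ℂ) : ℂ :=
  2 * ((r : ℂ) ^ 2 - (s : ℂ) ^ 2) / ((r : ℂ) ^ 2 * (1 - (r : ℂ) ^ 2) ^ 2) *
    (lam * (1 - s * lam) + r * (1 - (‖lam‖ : ℂ) ^ 2) * mu)

/-- The functions `f ∈ H₀` with `f(r) = s`, `f'(r) = w₁`, `f''(r) = w₂`. -/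
def Prescribed (r s : ℝ) (lam mu : ℂ) : Set (ℂ → ℂ) :=
  {f | f ∈ H0 ∧ f r = s ∧ deriv f r = w1 r s lam ∧ iteratedDeriv 2 f r = w2 r s lam mu}

noncomputable def A (r s : ℝ) : ℝ :=
  6 * (r ^ 2 - s ^ 2) / (r ^ 3 * (1 - r ^ 2) ^ 3)

noncomputable def B (r s : ℝ) (lam : ℂ) : ℂ :=
  (s : ℂ) ^ 2 * lam ^ 3 - s * (1 + (r : ℂ) ^ 2) * lam ^ 2 + (r : ℂ) ^ 2 * lam

/-- The center of the disk of values of the third derivative. -/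
noncomputable def c0 (r s : ℝ) (lam mu : ℂ) : ℂ :=
  A r s * (B r s lam + r * mu * (1 - (‖lam‖ : ℂ) ^ 2) *
    (1 + (r : ℂ) ^ 2 - 2 * s * lam - r * (starRingEnd ℂ) lam * mu))

/-- The radius of the disk of values of the third derivative. -/
noncomputable def rho0 (r s : ℝ) (lam mu : ℂ) : ℝ :=
  A r s * r ^ 2 * (1 - ‖lam‖ ^ 2) * (1 - ‖mu‖ ^ 2)

/-- `z ↦ z T_{s/r}(λ T_{-r}(z))` -/
noncomputable def extremal1 (r s : ℝ) (lam : ℂ) (z : ℂ) : ℂ :=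
  z * T (s / r) (lam * T (-r) z)

/-- `z ↦ z T_{s/r}(T_{-r}(z) T_λ(μ T_{-r}(z)))` -/
noncomputable def extremal2 (r s : ℝ) (lam mu : ℂ) (z : ℂ) : ℂ :=
  z * T (s / r) (T (-r) z * T lam (mu * T (-r) z))

/-- `z ↦ z T_{s/r}(T_{-r}(z) T_λ(T_{-r}(z) T_μ(e^{iθ} T_{-r}(z))))` -/
noncomputable def extremal3 (r s : ℝ) (lam mu : ℂ) (θ : ℝ) (z : ℂ) : ℂ :=
  z * T (s / r) (T (-r) z * T lam (T (-r) z * T mu (Complex.exp (θ * Complex.I) * T (-r) z)))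

end ThirdDieudonne

namespace ThirdDieudonne

open Filter Topology ComplexConjugate

/-! The proof is Schur's algorithm run at the interior point `r`. Schwarz's lemma writes `f = z * g`
with `g` in the Schur class and `g r = s / r`. Each step then peels off one Möbius layer, `G = T_a
(T_{-r} * H)` with `a = G r` and `H` again Schur (`exists_schur_eqOn`). In such a layer the
derivative of `G` at `r` is a nonzero multiple of `H r`, so prescribing successive derivatives of
`f` fixes the successive parameters `s / r`, `λ`, `μ`. A parameter of modulus one stops the
algorithm: by the maximum principle that Schur function is constant, whence uniqueness in the first
two cases. If `λ` and `μ` are both interior, the last Schur function `n` is unconstrained and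
`f'''(r) = c₀ + ρ₀ * n r`. As `n r` runs over the closed unit disk this fills the closed disk, and
its boundary is reached exactly when `n` is a unimodular constant. -/

/-- The Schur class: analytic functions on the unit disk bounded by one. -/
def Schur : Set (ℂ → ℂ) :=
  {f | DifferentiableOn ℂ f (ball 0 1) ∧ ∀ z ∈ ball (0 : ℂ) 1, ‖f z‖ ≤ 1}

/-! ### Möbius maps of the disk -/

lemma one_add_conj_mul_ne_zero {a z : ℂ} (ha : ‖a‖ < 1) (hz : ‖z‖ ≤ 1) : 1 + conj a * z ≠ 0 := by
  intro h
  have h1 : conj a * z = -1 := by linear_combination h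
  have h2 : ‖a‖ * ‖z‖ = 1 := by simpa using congrArg norm h1
  nlinarith [norm_nonneg a, norm_nonneg z]

lemma norm_sq_sub_norm_sq (a z : ℂ) :
    ‖1 + conj a * z‖ ^ 2 - ‖z + a‖ ^ 2 = (1 - ‖a‖ ^ 2) * (1 - ‖z‖ ^ 2) := by
  simp only [← Complex.normSq_eq_norm_sq, Complex.normSq_apply, Complex.add_re, Complex.add_im,
    Complex.mul_re, Complex.mul_im, Complex.conj_re, Complex.conj_im, Complex.one_re,
    Complex.one_im]
  ring

lemma norm_T_le_one {a z : ℂ} (ha : ‖a‖ < 1) (hz : ‖z‖ ≤ 1) : ‖T a z‖ ≤ 1 := by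
  have h := norm_sq_sub_norm_sq a z
  have h0 : 0 < ‖1 + conj a * z‖ := norm_pos_iff.2 (one_add_conj_mul_ne_zero ha hz)
  rw [T, norm_div, div_le_one h0]
  have h1 : 0 ≤ (1 - ‖a‖ ^ 2) * (1 - ‖z‖ ^ 2) :=
    mul_nonneg (by nlinarith [norm_nonneg a]) (by nlinarith [norm_nonneg z])
  exact le_of_sq_le_sq (by linarith) h0.le

lemma norm_T_lt_one {a z : ℂ} (ha : ‖a‖ < 1) (hz : ‖z‖ < 1) : ‖T a z‖ < 1 := by
  have h := norm_sq_sub_norm_sq a z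
  have h0 : 0 < ‖1 + conj a * z‖ := norm_pos_iff.2 (one_add_conj_mul_ne_zero ha hz.le)
  rw [T, norm_div, div_lt_one h0]
  have h1 : 0 < (1 - ‖a‖ ^ 2) * (1 - ‖z‖ ^ 2) :=
    mul_pos (by nlinarith [norm_nonneg a]) (by nlinarith [norm_nonneg z])
  exact lt_of_pow_lt_pow_left₀ 2 h0.le (by linarith)

lemma T_neg_self (a : ℂ) : T (-a) a = 0 := by simp [T]

lemma T_T_neg {a z : ℂ} (ha : ‖a‖ < 1) (hz : ‖z‖ ≤ 1) : T a (T (-a) z) = z := by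
  have h1 : 1 + conj (-a) * z ≠ 0 := one_add_conj_mul_ne_zero (by simpa using ha) hz
  have h2 : 1 + conj a * T (-a) z ≠ 0 :=
    one_add_conj_mul_ne_zero ha (norm_T_le_one (by simpa using ha) hz)
  have h3 : T (-a) z * (1 + conj (-a) * z) = z + -a := div_mul_cancel₀ _ h1
  rw [map_neg] at h3
  rw [T, div_eq_iff h2]
  linear_combination h3

lemma differentiableOn_T {a : ℂ} (ha : ‖a‖ < 1) : DifferentiableOn ℂ (T a) (closedBall 0 1) := by
  unfold T
  refine DifferentiableOn.div (by fun_prop) (by fun_prop) fun z hz => ?_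
  exact one_add_conj_mul_ne_zero ha (by simpa using hz)

lemma mapsTo_T {a : ℂ} (ha : ‖a‖ < 1) : MapsTo (T a) (ball 0 1) (ball 0 1) := fun z hz => by
  simpa using norm_T_lt_one ha (by simpa using hz)

/-! ### Schur's algorithm and the Schwarz lemma -/

/-- Schur's algorithm, one step: a function of the Schur class whose value at `c` is interior. -/
lemma exists_schur_eqOn {G : ℂ → ℂ} (hG : G ∈ Schur) {c : ℂ} (hc : ‖c‖ < 1) (hGc : ‖G c‖ < 1) :
    ∃ H ∈ Schur, EqOn G (fun z => T (G c) (T (-c) z * H z)) (ball 0 1) := by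
  have hc' : ‖-c‖ < 1 := by simpa using hc
  have ha' : ‖-G c‖ < 1 := by simpa using hGc
  -- Moving `c` and `G c` to the origin reduces the step to Schwarz's lemma: `Q z / z`, extended
  -- over `0` by `dslope`, is bounded by one.
  set Q : ℂ → ℂ := fun z => T (-G c) (G (T c z)) with hQ
  have hQ0 : Q 0 = 0 := by
    have : T c 0 = c := by simp [T]
    simp only [hQ, this, T_neg_self]
  have hQd : DifferentiableOn ℂ Q (ball 0 1) := by
    refine (differentiableOn_T ha').comp (hG.1.comp
      ((differentiableOn_T hc).mono ball_subset_closedBall) (mapsTo_T hc)) fun z hz => ?_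
    simpa using hG.2 _ (mapsTo_T hc hz)
  have hQm : MapsTo Q (ball 0 1) (closedBall (Q 0) 1) := fun z hz => by
    rw [hQ0]
    simpa using norm_T_le_one ha' (hG.2 _ (mapsTo_T hc hz))
  refine ⟨fun z => dslope Q 0 (T (-c) z), ⟨?_, fun z hz => ?_⟩, fun z hz => ?_⟩
  · exact ((Complex.differentiableOn_dslope (ball_mem_nhds 0 one_pos)).2 hQd).comp
      ((differentiableOn_T hc').mono ball_subset_closedBall) (mapsTo_T hc')
  · simpa using Complex.norm_dslope_le_div_of_mapsTo_ball hQd hQm (mapsTo_T hc' hz)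
  · have h1 : T (-c) z * dslope Q 0 (T (-c) z) = Q (T (-c) z) := by
      have := sub_smul_dslope Q 0 (T (-c) z)
      simpa [hQ0] using this
    have hz' : ‖z‖ ≤ 1 := (by simpa using hz : ‖z‖ < 1).le
    simp only [h1]
    simp only [hQ]
    rw [T_T_neg hc hz', T_T_neg hGc (hG.2 z hz)]

lemma mapsTo_T_T_mul {H : ℂ → ℂ} (hH : H ∈ Schur) {a c : ℂ} (ha : ‖a‖ < 1) (hc : ‖c‖ < 1) :
    MapsTo (fun z => T a (T (-c) z * H z)) (ball 0 1) (ball 0 1) := fun z hz => by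
  have h1 : ‖T (-c) z‖ < 1 := norm_T_lt_one (by simpa using hc) (by simpa using hz)
  have h2 := hH.2 z hz
  have : ‖T a (T (-c) z * H z)‖ < 1 := by
    refine norm_T_lt_one ha ?_
    rw [norm_mul]
    nlinarith [norm_nonneg (H z), norm_nonneg (T (-c) z)]
  simpa using this

lemma T_T_mul_mem_schur {H : ℂ → ℂ} (hH : H ∈ Schur) {a c : ℂ} (ha : ‖a‖ < 1) (hc : ‖c‖ < 1) :
    (fun z => T a (T (-c) z * H z)) ∈ Schur := by
  refine ⟨?_, fun z hz => ?_⟩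
  · refine (differentiableOn_T ha).comp
      ((((differentiableOn_T (a := -c) (by simpa using hc)).mono ball_subset_closedBall)).mul hH.1)
      fun z hz => ?_
    have h1 : ‖T (-c) z‖ < 1 := norm_T_lt_one (by simpa using hc) (by simpa using hz)
    have h2 := hH.2 z hz
    simp only [mem_closedBall, dist_zero_right, norm_mul]
    nlinarith [norm_nonneg (H z), norm_nonneg (T (-c) z)]
  · have := mapsTo_T_T_mul hH ha hc hz
    exact (by simpa using this : ‖T a (T (-c) z * H z)‖ < 1).le

/-- Maximum modulus principle: this is where the algorithm terminates. -/
lemma eqOn_const_of_norm_eq_one {G : ℂ → ℂ} (hG : G ∈ Schur) {c : ℂ} (hc : ‖c‖ < 1)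
    (hGc : ‖G c‖ = 1) : EqOn G (fun _ => G c) (ball 0 1) :=
  Complex.eqOn_of_isPreconnected_of_isMaxOn_norm (convex_ball 0 1).isPreconnected isOpen_ball hG.1
    (by simpa using hc) fun z hz => by simpa [hGc] using hG.2 z hz

lemma const_mem_schur {e : ℂ} (he : ‖e‖ ≤ 1) : (fun _ => e) ∈ Schur :=
  ⟨differentiableOn_const e, fun _ _ => he⟩

/-- The Schwarz lemma as a factorization. -/
lemma exists_schur_eqOn_mul {f : ℂ → ℂ} (hf : f ∈ H0) :
    ∃ g ∈ Schur, EqOn f (fun z => z * g z) (ball 0 1) := by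
  obtain ⟨hd, hm, h0⟩ := hf
  have hS : f ∈ Schur := ⟨hd, fun z hz => (by simpa using hm hz : ‖f z‖ < 1).le⟩
  -- With `c = 0` and `f 0 = 0` both Möbius maps are the identity.
  obtain ⟨g, hg, h⟩ := exists_schur_eqOn hS (c := 0) (by simp) (by simp [h0])
  refine ⟨g, hg, fun z hz => ?_⟩
  simpa [h0, T] using h hz

lemma mul_mem_H0 {g : ℂ → ℂ} (hg : g ∈ Schur) : (fun z => z * g z) ∈ H0 := by
  refine ⟨differentiableOn_id.mul hg.1, fun z hz => ?_, by simp⟩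
  have hz' : ‖z‖ < 1 := by simpa using hz
  have := hg.2 z hz
  simp only [mem_ball, dist_zero_right, norm_mul]
  nlinarith [norm_nonneg (g z), norm_nonneg z]

lemma mem_H0_congr {f g : ℂ → ℂ} (hg : g ∈ H0) (h : EqOn f g (ball 0 1)) : f ∈ H0 :=
  ⟨hg.1.congr h, hg.2.1.congr h.symm, by rw [h (by simp)]; exact hg.2.2⟩

lemma analyticAt_of_mem_schur {G : ℂ → ℂ} (hG : G ∈ Schur) {c : ℂ} (hc : ‖c‖ < 1) :
    AnalyticAt ℂ G c :=
  hG.1.analyticAt (isOpen_ball.mem_nhds (by simpa using hc))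

lemma eventuallyEq_of_eqOn_ball {f g : ℂ → ℂ} (h : EqOn f g (ball 0 1)) {c : ℂ} (hc : ‖c‖ < 1) :
    f =ᶠ[𝓝 c] g :=
  h.eventuallyEq_of_mem (isOpen_ball.mem_nhds (by simpa using hc))

/-! ### Derivatives up to order three at `r` -/

lemma iteratedDeriv_mul_eq {f g : ℂ → ℂ} {c : ℂ} (hf : AnalyticAt ℂ f c) (hg : AnalyticAt ℂ g c) :
    deriv (fun z => f z * g z) c = deriv f c * g c + f c * deriv g c ∧
    iteratedDeriv 2 (fun z => f z * g z) c =
      iteratedDeriv 2 f c * g c + 2 * (deriv f c * deriv g c) + f c * iteratedDeriv 2 g c ∧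
    iteratedDeriv 3 (fun z => f z * g z) c =
      iteratedDeriv 3 f c * g c + 3 * (iteratedDeriv 2 f c * deriv g c) +
        3 * (deriv f c * iteratedDeriv 2 g c) + f c * iteratedDeriv 3 g c := by
  refine ⟨deriv_fun_mul hf.differentiableAt hg.differentiableAt, ?_, ?_⟩
  · rw [iteratedDeriv_fun_mul hf.contDiffAt hg.contDiffAt]
    simp [Finset.sum_range_succ, iteratedDeriv_one]
    ring
  · rw [iteratedDeriv_fun_mul hf.contDiffAt hg.contDiffAt]
    simp [Finset.sum_range_succ, iteratedDeriv_one, Nat.choose]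
    ring

lemma iteratedDeriv_affine (p q c : ℂ) :
    deriv (fun z => p + q * z) c = q ∧ iteratedDeriv 2 (fun z => p + q * z) c = 0 ∧
      iteratedDeriv 3 (fun z => p + q * z) c = 0 := by
  have h : deriv (fun z => p + q * z) = fun _ => q := by
    ext z; simp
  refine ⟨by rw [h], ?_, ?_⟩ <;> simp [iteratedDeriv_succ', h]

lemma iteratedDeriv_id_mul_eq {g : ℂ → ℂ} {c : ℂ} (hg : AnalyticAt ℂ g c) :
    deriv (fun z => z * g z) c = g c + c * deriv g c ∧
    iteratedDeriv 2 (fun z => z * g z) c = 2 * deriv g c + c * iteratedDeriv 2 g c ∧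
    iteratedDeriv 3 (fun z => z * g z) c = 3 * iteratedDeriv 2 g c + c * iteratedDeriv 3 g c := by
  have h := iteratedDeriv_mul_eq (f := fun z => 0 + 1 * z) (by fun_prop) hg
  obtain ⟨h1, h2, h3⟩ := iteratedDeriv_affine 0 1 c
  rw [h1, h2, h3] at h
  simpa using h

/-- The derivatives of `α + β z + (z - c) γ H`. -/
lemma iteratedDeriv_affine_add {H : ℂ → ℂ} {c : ℂ} (hH : AnalyticAt ℂ H c) (α β γ : ℂ) :
    deriv (fun z => α + β * z + (-c + 1 * z) * (γ * H z)) c = β + γ * H c ∧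
    iteratedDeriv 2 (fun z => α + β * z + (-c + 1 * z) * (γ * H z)) c = 2 * (γ * deriv H c) ∧
    iteratedDeriv 3 (fun z => α + β * z + (-c + 1 * z) * (γ * H z)) c =
      3 * (γ * iteratedDeriv 2 H c) := by
  have hγ : AnalyticAt ℂ (fun z => γ * H z) c := by fun_prop
  have h := iteratedDeriv_mul_eq (f := fun z => -c + 1 * z) (by fun_prop) hγ
  obtain ⟨h1, h2, h3⟩ := iteratedDeriv_affine (-c) 1 c
  obtain ⟨k1, k2, k3⟩ := iteratedDeriv_affine α β c
  have hp : AnalyticAt ℂ (fun z => (-c + 1 * z) * (γ * H z)) c := by fun_prop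
  have hl : AnalyticAt ℂ (fun z => α + β * z) c := by fun_prop
  rw [h1, h2, h3] at h
  refine ⟨?_, ?_, ?_⟩
  · rw [deriv_fun_add hl.differentiableAt hp.differentiableAt, k1, h.1]; simp
  · rw [iteratedDeriv_fun_add hl.contDiffAt hp.contDiffAt, k2, h.2.1]; simp
  · rw [iteratedDeriv_fun_add hl.contDiffAt hp.contDiffAt, k3, h.2.2]; simp

lemma one_sub_sq_ne_zero {r : ℝ} (h0 : 0 < r) (h1 : r < 1) : 1 - (r : ℂ) ^ 2 ≠ 0 := by
  have : (1 - r ^ 2 : ℝ) ≠ 0 := by nlinarith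
  exact_mod_cast this

/-- The derivatives of `T_a (T_{-r} H)` at `r`. -/
lemma iteratedDeriv_T_T_mul {G H : ℂ → ℂ} (hH : H ∈ Schur) {a : ℂ} (ha : ‖a‖ < 1) {r : ℝ}
    (h0 : 0 < r) (h1 : r < 1) (hG : EqOn G (fun z => T a (T (-r) z * H z)) (ball 0 1)) :
    G r = a ∧
    deriv G r = (1 - a * conj a) * H r / (1 - (r : ℂ) ^ 2) ∧
    iteratedDeriv 2 G r = 2 * (1 - a * conj a) / (1 - (r : ℂ) ^ 2) ^ 2 *
      ((1 - (r : ℂ) ^ 2) * deriv H r + r * H r - conj a * H r ^ 2) ∧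
    iteratedDeriv 3 G r = 6 * (1 - a * conj a) / (1 - (r : ℂ) ^ 2) ^ 3 *
      ((1 - (r : ℂ) ^ 2) ^ 2 * iteratedDeriv 2 H r / 2 + r * (1 - (r : ℂ) ^ 2) * deriv H r
        + r ^ 2 * H r - 2 * conj a * H r * ((1 - (r : ℂ) ^ 2) * deriv H r + r * H r)
        + conj a ^ 2 * H r ^ 3) := by
  have hr : ‖(r : ℂ)‖ < 1 := by simpa [abs_of_pos h0] using h1
  have hr' : ‖-(r : ℂ)‖ < 1 := by simpa using hr
  have hq := one_sub_sq_ne_zero h0 h1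
  have hGS : G ∈ Schur := by
    have := T_T_mul_mem_schur hH ha hr
    exact ⟨this.1.congr hG, fun z hz => by rw [hG hz]; exact this.2 z hz⟩
  have hGa := analyticAt_of_mem_schur hGS hr
  have hHa := analyticAt_of_mem_schur hH hr
  have hval : G r = a := by
    rw [hG (by simpa using hr)]
    simp [T]
  -- Multiplying numerator and denominator of `G` by `1 - r * z` gives `G * D = N`, so the product
  -- rule replaces the quotient rule. Since `D r = 1 - r ^ 2` is nonzero, the derivatives of `G`
  -- follow recursively.
  set D : ℂ → ℂ := fun z => 1 + (-r) * z + (-(r : ℂ) + 1 * z) * (conj a * H z) with hD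
  set N : ℂ → ℂ := fun z => a + (-(a * r)) * z + (-(r : ℂ) + 1 * z) * (1 * H z) with hN
  have hDa : AnalyticAt ℂ D r := by fun_prop
  have heq : (fun z => G z * D z) =ᶠ[𝓝 (r : ℂ)] N := by
    refine eventuallyEq_of_eqOn_ball (fun z hz => ?_) hr
    have hz' : ‖z‖ < 1 := by simpa using hz
    have e1 : 1 + conj (-(r : ℂ)) * z ≠ 0 := one_add_conj_mul_ne_zero hr' hz'.le
    have e2 : 1 + conj a * (T (-r) z * H z) ≠ 0 := by
      refine one_add_conj_mul_ne_zero ha ?_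
      rw [norm_mul]
      nlinarith [norm_nonneg (H z), norm_nonneg (T (-r) z), hH.2 z hz, norm_T_lt_one hr' hz']
    have e3 : T (-r) z * (1 + conj (-(r : ℂ)) * z) = z + -r :=
      div_mul_cancel₀ _ e1
    have e4 : G z * (1 + conj a * (T (-r) z * H z)) = T (-r) z * H z + a := by
      rw [hG hz]
      exact div_mul_cancel₀ _ e2
    have e5 : conj (-(r : ℂ)) = -r := by simp
    rw [e5] at e3
    simp only [hD, hN]
    linear_combination (1 + -(r : ℂ) * z) * e4 + (H z - G z * conj a * H z) * e3
  obtain ⟨d1, d2, d3⟩ := iteratedDeriv_affine_add hHa 1 (-r) (conj a)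
  obtain ⟨n1, n2, n3⟩ := iteratedDeriv_affine_add hHa a (-(a * r)) 1
  obtain ⟨l1, l2, l3⟩ := iteratedDeriv_mul_eq hGa hDa
  have hD0 : D r = 1 - (r : ℂ) ^ 2 := by simp only [hD]; ring
  rw [heq.deriv_eq, n1, hD0, d1, hval] at l1
  rw [heq.iteratedDeriv_eq, n2, hD0, d1, d2, hval] at l2
  rw [heq.iteratedDeriv_eq, n3, hD0, d1, d2, d3, hval] at l3
  have g1 : deriv G r = (1 - a * conj a) * H r / (1 - (r : ℂ) ^ 2) := by
    rw [eq_div_iff hq]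
    linear_combination -l1
  have g2 : iteratedDeriv 2 G r = 2 * (1 - a * conj a) / (1 - (r : ℂ) ^ 2) ^ 2 *
      ((1 - (r : ℂ) ^ 2) * deriv H r + r * H r - conj a * H r ^ 2) := by
    rw [g1] at l2
    refine mul_right_cancel₀ hq ?_
    rw [← sub_eq_zero] at l2 ⊢
    rw [← neg_eq_zero, ← l2]
    field_simp
    ring
  refine ⟨hval, g1, g2, ?_⟩
  rw [g1, g2] at l3
  refine mul_right_cancel₀ hq ?_
  rw [← sub_eq_zero] at l3 ⊢
  rw [← neg_eq_zero, ← l3]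
  field_simp
  ring

/-! ### Parametrization of the prescribed class -/

lemma norm_ofReal_div_lt_one {r s : ℝ} (hs : 0 ≤ s) (hsr : s < r) : ‖(s / r : ℂ)‖ < 1 := by
  have hr : 0 < r := hs.trans_lt hsr
  rw [← Complex.ofReal_div, Complex.norm_real, Real.norm_of_nonneg (by positivity)]
  exact (div_lt_one hr).2 hsr

lemma norm_ofReal_lt_one {r : ℝ} (h0 : 0 < r) (hr : r < 1) : ‖(r : ℂ)‖ < 1 := by
  simpa [abs_of_pos h0] using hr

lemma mul_conj_eq_norm_sq (a : ℂ) : a * conj a = (‖a‖ : ℂ) ^ 2 := Complex.mul_conj' a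

lemma norm_sq_ne_one {a : ℂ} (ha : ‖a‖ < 1) : 1 - (‖a‖ : ℂ) ^ 2 ≠ 0 := by
  have : (1 - ‖a‖ ^ 2 : ℝ) ≠ 0 := by nlinarith [norm_nonneg a]
  exact_mod_cast this

/-- The factors `1 - r ^ 2` stay attached to the derivatives of `k`, ready for the next layer, whose
formulas carry the inverse factors. -/
lemma iteratedDeriv_mul_T_T_mul {r s : ℝ} (hs : 0 ≤ s) (hsr : s < r) (hr : r < 1)
    {f k : ℂ → ℂ} (hk : k ∈ Schur)
    (hf : EqOn f (fun z => z * T (s / r) (T (-r) z * k z)) (ball 0 1)) :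
    f ∈ H0 ∧ f r = s ∧ deriv f r = w1 r s (k r) ∧
    iteratedDeriv 2 f r = 2 * ((r : ℂ) ^ 2 - (s : ℂ) ^ 2) / ((r : ℂ) ^ 2 * (1 - (r : ℂ) ^ 2) ^ 2) *
      (k r * (1 - s * k r) + r * ((1 - (r : ℂ) ^ 2) * deriv k r)) ∧
    iteratedDeriv 3 f r = A r s * (B r s (k r) +
      r * ((1 - (r : ℂ) ^ 2) * deriv k r) * (1 - 2 * s * k r) +
      r ^ 2 * ((1 - (r : ℂ) ^ 2) ^ 2 * iteratedDeriv 2 k r) / 2) := by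
  have h0 : 0 < r := hs.trans_lt hsr
  have hrc : (r : ℂ) ≠ 0 := by exact_mod_cast h0.ne'
  have hu := norm_ofReal_div_lt_one hs hsr
  have hn := norm_ofReal_lt_one h0 hr
  have hq := one_sub_sq_ne_zero h0 hr
  have hg := T_T_mul_mem_schur hk hu hn
  obtain ⟨g0, g1, g2, g3⟩ := iteratedDeriv_T_T_mul hk hu h0 hr (fun z _ => rfl)
  have hev := eventuallyEq_of_eqOn_ball hf hn
  obtain ⟨f1, f2, f3⟩ := iteratedDeriv_id_mul_eq (analyticAt_of_mem_schur hg hn)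
  have hconj : conj (s / r : ℂ) = s / r := by simp
  rw [hconj] at g1 g2 g3
  refine ⟨mem_H0_congr (mul_mem_H0 hg) hf, ?_, ?_, ?_, ?_⟩
  · rw [hf (by simpa using hn)]
    simp only
    rw [g0]
    field_simp
  · rw [hev.deriv_eq, f1, g0, g1, w1]
    field_simp
  · rw [hev.iteratedDeriv_eq, f2, g1, g2]
    field_simp
    ring
  · rw [hev.iteratedDeriv_eq, f3, g2, g3, A, B]
    push_cast
    field_simp
    ring

/-- Since `s < r`, the coefficients of `k r` in `f'(r)` and of `deriv k r` in `f''(r)` are nonzero,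
so the conditions on `f` can be solved for those of `k`. -/
lemma mem_prescribed_iff {r s : ℝ} (hs : 0 ≤ s) (hsr : s < r) (hr : r < 1)
    {lam mu : ℂ} {f : ℂ → ℂ} :
    f ∈ Prescribed r s lam mu ↔ ∃ k ∈ Schur,
      EqOn f (fun z => z * T (s / r) (T (-r) z * k z)) (ball 0 1) ∧ k r = lam ∧
      (1 - (r : ℂ) ^ 2) * deriv k r = (1 - (‖lam‖ : ℂ) ^ 2) * mu := by
  have h0 : 0 < r := hs.trans_lt hsr
  have hrc : (r : ℂ) ≠ 0 := by exact_mod_cast h0.ne'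
  have hu := norm_ofReal_div_lt_one hs hsr
  have hn := norm_ofReal_lt_one h0 hr
  have hq := one_sub_sq_ne_zero h0 hr
  have hd : (r : ℂ) ^ 2 - (s : ℂ) ^ 2 ≠ 0 := by
    have : (r ^ 2 - s ^ 2 : ℝ) ≠ 0 := by nlinarith
    exact_mod_cast this
  constructor
  · rintro ⟨hf, f0, f1, f2⟩
    obtain ⟨g, hg, hfg⟩ := exists_schur_eqOn_mul hf
    have hgr : g r = s / r := by
      have := hfg (x := r) (by simpa using hn)
      simp only [f0] at this
      rw [this]
      field_simp
    obtain ⟨k, hk, hgk⟩ := exists_schur_eqOn hg hn (by rwa [hgr])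
    rw [hgr] at hgk
    have hfk : EqOn f (fun z => z * T (s / r) (T (-r) z * k z)) (ball 0 1) := fun z hz => by
      rw [hfg hz]
      simp only [hgk hz]
    obtain ⟨-, -, e1, e2, -⟩ := iteratedDeriv_mul_T_T_mul hs hsr hr hk hfk
    have hlam : k r = lam := by
      rw [f1, w1, w1] at e1
      have hc : ((r : ℂ) ^ 2 - (s : ℂ) ^ 2) / (r * (1 - (r : ℂ) ^ 2)) ≠ 0 :=
        div_ne_zero hd (mul_ne_zero hrc hq)
      exact (mul_left_cancel₀ hc (add_left_cancel e1)).symm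
    refine ⟨k, hk, hfk, hlam, ?_⟩
    rw [f2, w2, hlam] at e2
    have hc : 2 * ((r : ℂ) ^ 2 - (s : ℂ) ^ 2) / ((r : ℂ) ^ 2 * (1 - (r : ℂ) ^ 2) ^ 2) ≠ 0 :=
      div_ne_zero (mul_ne_zero two_ne_zero hd) (mul_ne_zero (pow_ne_zero _ hrc) (pow_ne_zero _ hq))
    have e3 := add_left_cancel (mul_left_cancel₀ hc e2)
    exact mul_left_cancel₀ hrc (by linear_combination -e3)
  · rintro ⟨k, hk, hfk, hlam, hk1⟩
    obtain ⟨e, e0, e1, e2, -⟩ := iteratedDeriv_mul_T_T_mul hs hsr hr hk hfk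
    refine ⟨e, e0, by rw [e1, hlam], ?_⟩
    rw [e2, hk1, hlam, w2]
    ring

lemma mem_prescribed_iff_of_norm_lt_one {r s : ℝ} (hs : 0 ≤ s) (hsr : s < r) (hr : r < 1)
    {lam mu : ℂ} (hlam : ‖lam‖ < 1) {f : ℂ → ℂ} :
    f ∈ Prescribed r s lam mu ↔ ∃ m ∈ Schur,
      EqOn f (fun z => z * T (s / r) (T (-r) z * T lam (T (-r) z * m z))) (ball 0 1) ∧
      m r = mu := by
  have h0 : 0 < r := hs.trans_lt hsr
  have hn := norm_ofReal_lt_one h0 hr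
  have hq := one_sub_sq_ne_zero h0 hr
  have hL := norm_sq_ne_one hlam
  rw [mem_prescribed_iff hs hsr hr]
  constructor
  · rintro ⟨k, hk, hfk, rfl, hk1⟩
    obtain ⟨m, hm, hkm⟩ := exists_schur_eqOn hk hn hlam
    obtain ⟨-, e1, -⟩ := iteratedDeriv_T_T_mul hm hlam h0 hr hkm
    refine ⟨m, hm, fun z hz => ?_, ?_⟩
    · rw [hfk hz]
      simp only [hkm hz]
    · rw [e1, mul_conj_eq_norm_sq, mul_div_cancel₀ _ hq] at hk1
      exact mul_left_cancel₀ hL hk1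
  · rintro ⟨m, hm, hfm, rfl⟩
    obtain ⟨e0, e1, -⟩ := iteratedDeriv_T_T_mul hm hlam h0 hr (fun z _ => rfl)
    refine ⟨_, T_T_mul_mem_schur hm hlam hn, hfm, e0, ?_⟩
    rw [e1, mul_conj_eq_norm_sq, mul_div_cancel₀ _ hq]

/-- Serves both cases with `λ` interior: if `|μ| = 1` then `m` is constant and only `c₀` survives;
otherwise one more layer turns the last term into `ρ₀ * n r`. -/
lemma iteratedDeriv_three_of_eqOn {r s : ℝ} (hs : 0 ≤ s) (hsr : s < r) (hr : r < 1)
    {lam : ℂ} (hlam : ‖lam‖ < 1) {f m : ℂ → ℂ} (hm : m ∈ Schur)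
    (hf : EqOn f (fun z => z * T (s / r) (T (-r) z * T lam (T (-r) z * m z))) (ball 0 1)) :
    iteratedDeriv 3 f r = c0 r s lam (m r) +
      A r s * r ^ 2 * (1 - (‖lam‖ : ℂ) ^ 2) * ((1 - (r : ℂ) ^ 2) * deriv m r) := by
  have h0 : 0 < r := hs.trans_lt hsr
  have hn := norm_ofReal_lt_one h0 hr
  have hq := one_sub_sq_ne_zero h0 hr
  obtain ⟨e0, e1, e2, -⟩ := iteratedDeriv_T_T_mul hm hlam h0 hr (fun z _ => rfl)
  obtain ⟨-, -, -, -, e⟩ :=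
    iteratedDeriv_mul_T_T_mul hs hsr hr (T_T_mul_mem_schur hm hlam hn) hf
  rw [e, e0, e1, e2, mul_conj_eq_norm_sq, c0]
  field_simp
  ring

lemma mem_prescribed_iff_of_norm_lt_one_of_norm_lt_one {r s : ℝ} (hs : 0 ≤ s) (hsr : s < r) (hr : r < 1)
    {lam mu : ℂ} (hlam : ‖lam‖ < 1)
    (hmu : ‖mu‖ < 1) {f : ℂ → ℂ} :
    f ∈ Prescribed r s lam mu ↔ ∃ n ∈ Schur,
      EqOn f (fun z => z * T (s / r) (T (-r) z * T lam (T (-r) z * T mu (T (-r) z * n z))))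
        (ball 0 1) := by
  have h0 : 0 < r := hs.trans_lt hsr
  have hn := norm_ofReal_lt_one h0 hr
  rw [mem_prescribed_iff_of_norm_lt_one hs hsr hr hlam]
  constructor
  · rintro ⟨m, hm, hfm, rfl⟩
    obtain ⟨n, hnS, hmn⟩ := exists_schur_eqOn hm hn hmu
    refine ⟨n, hnS, fun z hz => ?_⟩
    rw [hfm hz]
    simp only [hmn hz]
  · rintro ⟨n, hnS, hfn⟩
    exact ⟨_, T_T_mul_mem_schur hnS hmu hn, hfn,
      (iteratedDeriv_T_T_mul hnS hmu h0 hr (fun z _ => rfl)).1⟩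

lemma iteratedDeriv_three_eq_add_rho0_mul {r s : ℝ} (hs : 0 ≤ s) (hsr : s < r) (hr : r < 1)
    {lam mu : ℂ} (hlam : ‖lam‖ < 1)
    (hmu : ‖mu‖ < 1) {f n : ℂ → ℂ} (hnS : n ∈ Schur)
    (hf : EqOn f (fun z => z * T (s / r) (T (-r) z * T lam (T (-r) z * T mu (T (-r) z * n z))))
        (ball 0 1)) :
    iteratedDeriv 3 f r = c0 r s lam mu + rho0 r s lam mu * n r := by
  have h0 : 0 < r := hs.trans_lt hsr
  have hn := norm_ofReal_lt_one h0 hr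
  have hq := one_sub_sq_ne_zero h0 hr
  obtain ⟨e0, e1, -⟩ := iteratedDeriv_T_T_mul hnS hmu h0 hr (fun z _ => rfl)
  rw [iteratedDeriv_three_of_eqOn hs hsr hr hlam (T_T_mul_mem_schur hnS hmu hn) hf, e0, e1,
    mul_conj_eq_norm_sq, mul_div_cancel₀ _ hq, rho0]
  push_cast
  ring

lemma rho0_pos {r s : ℝ} (hs : 0 ≤ s) (hsr : s < r) (hr : r < 1)
    {lam mu : ℂ} (hlam : ‖lam‖ < 1) (hmu : ‖mu‖ < 1) : 0 < rho0 r s lam mu := by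
  have h0 : 0 < r := hs.trans_lt hsr
  have h1 : 0 < 1 - r ^ 2 := by nlinarith
  have h2 : 0 < r ^ 2 - s ^ 2 := by nlinarith
  have h3 : 0 < 1 - ‖lam‖ ^ 2 := by nlinarith [norm_nonneg lam]
  have h4 : 0 < 1 - ‖mu‖ ^ 2 := by nlinarith [norm_nonneg mu]
  unfold rho0 A
  positivity

/-! ### Extremal functions and the disk of values -/

lemma extremal1_mem_prescribed {r s : ℝ} (hs : 0 ≤ s) (hsr : s < r) (hr : r < 1)
    {lam : ℂ} (hlam : ‖lam‖ = 1) (mu : ℂ) :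
    extremal1 r s lam ∈ Prescribed r s lam mu := by
  rw [mem_prescribed_iff hs hsr hr]
  -- The derivative condition reads `0 = 0` because `1 - |λ|² = 0`, so every `mu` is admissible.
  refine ⟨fun _ => lam, const_mem_schur hlam.le, fun z _ => ?_, rfl, by simp [hlam]⟩
  simp only [extremal1, mul_comm]

lemma eqOn_extremal1 {r s : ℝ} (hs : 0 ≤ s) (hsr : s < r) (hr : r < 1)
    {lam mu : ℂ} (hlam : ‖lam‖ = 1) {f : ℂ → ℂ}
    (hf : f ∈ Prescribed r s lam mu) :
    iteratedDeriv 3 f r = c0 r s lam mu ∧ EqOn f (extremal1 r s lam) (ball 0 1) := by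
  have hn := norm_ofReal_lt_one (hs.trans_lt hsr) hr
  obtain ⟨k, hk, hfk, rfl, -⟩ := (mem_prescribed_iff hs hsr hr).1 hf
  have hc := eqOn_const_of_norm_eq_one hk hn hlam
  have hf' : EqOn f (fun z => z * T (s / r) (T (-r) z * (fun _ => k r) z)) (ball 0 1) :=
    fun z hz => by rw [hfk hz]; simp only [hc hz]
  refine ⟨?_, fun z hz => ?_⟩
  · rw [(iteratedDeriv_mul_T_T_mul hs hsr hr (const_mem_schur hlam.le) hf').2.2.2.2, c0, hlam]
    simp [iteratedDeriv_const]
  · rw [hf' hz]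
    simp only [extremal1, mul_comm]

lemma extremal2_mem_prescribed {r s : ℝ} (hs : 0 ≤ s) (hsr : s < r) (hr : r < 1)
    {lam mu : ℂ} (hlam : ‖lam‖ < 1) (hmu : ‖mu‖ = 1) :
    extremal2 r s lam mu ∈ Prescribed r s lam mu := by
  rw [mem_prescribed_iff_of_norm_lt_one hs hsr hr hlam]
  exact ⟨fun _ => mu, const_mem_schur hmu.le, fun z _ => by rw [extremal2, mul_comm mu], rfl⟩

lemma eqOn_extremal2 {r s : ℝ} (hs : 0 ≤ s) (hsr : s < r) (hr : r < 1)
    {lam mu : ℂ} (hlam : ‖lam‖ < 1) (hmu : ‖mu‖ = 1) {f : ℂ → ℂ}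
    (hf : f ∈ Prescribed r s lam mu) :
    iteratedDeriv 3 f r = c0 r s lam mu ∧ EqOn f (extremal2 r s lam mu) (ball 0 1) := by
  have hn := norm_ofReal_lt_one (hs.trans_lt hsr) hr
  obtain ⟨m, hm, hfm, rfl⟩ := (mem_prescribed_iff_of_norm_lt_one hs hsr hr hlam).1 hf
  have hc := eqOn_const_of_norm_eq_one hm hn hmu
  refine ⟨?_, fun z hz => ?_⟩
  · rw [iteratedDeriv_three_of_eqOn hs hsr hr hlam hm hfm,
      (eventuallyEq_of_eqOn_ball hc hn).deriv_eq]
    simp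
  · rw [hfm hz, extremal2, mul_comm (m r)]
    simp only [hc hz]

lemma extremal3_mem_prescribed {r s : ℝ} (hs : 0 ≤ s) (hsr : s < r) (hr : r < 1)
    {lam mu : ℂ} (hlam : ‖lam‖ < 1) (hmu : ‖mu‖ < 1) (θ : ℝ) :
    extremal3 r s lam mu θ ∈ Prescribed r s lam mu := by
  rw [mem_prescribed_iff_of_norm_lt_one_of_norm_lt_one hs hsr hr hlam hmu]
  exact ⟨fun _ => Complex.exp (θ * Complex.I),
    const_mem_schur (Complex.norm_exp_ofReal_mul_I θ).le,
    fun z _ => by rw [extremal3, mul_comm (Complex.exp _)]⟩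

lemma image_iteratedDeriv_three {r s : ℝ} (hs : 0 ≤ s) (hsr : s < r) (hr : r < 1)
    {lam mu : ℂ} (hlam : ‖lam‖ < 1) (hmu : ‖mu‖ < 1) :
    (fun f : ℂ → ℂ => iteratedDeriv 3 f (r : ℂ)) '' Prescribed r s lam mu =
      closedBall (c0 r s lam mu) (rho0 r s lam mu) := by
  have hn := norm_ofReal_lt_one (hs.trans_lt hsr) hr
  have hρ := rho0_pos hs hsr hr hlam hmu
  have hρc : (rho0 r s lam mu : ℂ) ≠ 0 := by exact_mod_cast hρ.ne'
  ext ζ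
  simp only [mem_image, mem_closedBall, dist_eq_norm]
  constructor
  · rintro ⟨f, hf, rfl⟩
    obtain ⟨n, hnS, hfn⟩ :=
      (mem_prescribed_iff_of_norm_lt_one_of_norm_lt_one hs hsr hr hlam hmu).1 hf
    rw [iteratedDeriv_three_eq_add_rho0_mul hs hsr hr hlam hmu hnS hfn, add_sub_cancel_left,
      norm_mul, Complex.norm_real, Real.norm_of_nonneg hρ.le]
    exact mul_le_of_le_one_right hρ.le (hnS.2 _ (by simpa using hn))
  · intro hζ
    -- Constant Schur functions already attain every value of the disk.
    have he : (fun _ : ℂ => (ζ - c0 r s lam mu) / rho0 r s lam mu) ∈ Schur := by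
      refine const_mem_schur ?_
      rw [norm_div, Complex.norm_real, Real.norm_of_nonneg hρ.le]
      exact (div_le_one hρ).2 hζ
    refine ⟨_, (mem_prescribed_iff_of_norm_lt_one_of_norm_lt_one hs hsr hr hlam hmu).2
      ⟨_, he, fun z _ => rfl⟩, ?_⟩
    rw [iteratedDeriv_three_eq_add_rho0_mul hs hsr hr hlam hmu he (fun z _ => rfl),
      mul_div_cancel₀ _ hρc, add_sub_cancel]

lemma iteratedDeriv_three_mem_sphere_iff {r s : ℝ} (hs : 0 ≤ s) (hsr : s < r) (hr : r < 1)
    {lam mu : ℂ} (hlam : ‖lam‖ < 1) (hmu : ‖mu‖ < 1)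
    {f : ℂ → ℂ} (hf : f ∈ Prescribed r s lam mu) :
    iteratedDeriv 3 f (r : ℂ) ∈ sphere (c0 r s lam mu) (rho0 r s lam mu) ↔
      ∃ θ : ℝ, EqOn f (extremal3 r s lam mu θ) (ball 0 1) := by
  have hn := norm_ofReal_lt_one (hs.trans_lt hsr) hr
  have hρ := rho0_pos hs hsr hr hlam hmu
  -- Stated for every `n` representing `f`, since it is applied both to the `n` found by the
  -- algorithm and to the constant `e^{iθ}`.
  have key : ∀ {n : ℂ → ℂ}, n ∈ Schur → EqOn f (fun z => z * T (s / r) (T (-r) z *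
      T lam (T (-r) z * T mu (T (-r) z * n z)))) (ball 0 1) →
      (iteratedDeriv 3 f (r : ℂ) ∈ sphere (c0 r s lam mu) (rho0 r s lam mu) ↔ ‖n r‖ = 1) := by
    intro n hnS hfn
    rw [mem_sphere, dist_eq_norm, iteratedDeriv_three_eq_add_rho0_mul hs hsr hr hlam hmu hnS hfn,
      add_sub_cancel_left, norm_mul, Complex.norm_real, Real.norm_of_nonneg hρ.le,
      mul_eq_left₀ hρ.ne']
  constructor
  · obtain ⟨n, hnS, hfn⟩ :=
      (mem_prescribed_iff_of_norm_lt_one_of_norm_lt_one hs hsr hr hlam hmu).1 hf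
    rw [key hnS hfn]
    intro h1
    obtain ⟨θ, hθ⟩ := (Complex.norm_eq_one_iff _).1 h1
    have hc := eqOn_const_of_norm_eq_one hnS hn h1
    refine ⟨θ, fun z hz => ?_⟩
    rw [hfn hz, extremal3, hθ, mul_comm (n r)]
    simp only [hc hz]
  · rintro ⟨θ, hθ⟩
    refine (key (n := fun _ => Complex.exp (θ * Complex.I))
      (const_mem_schur (Complex.norm_exp_ofReal_mul_I θ).le) fun z hz => ?_).2
      (Complex.norm_exp_ofReal_mul_I θ)
    rw [hθ hz, extremal3, mul_comm (Complex.exp _)]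

end ThirdDieudonne

theorem mainTheorem2 (r s : ℝ) (hs : 0 ≤ s) (hsr : s < r) (hr : r < 1)
    (lam mu : ℂ) (hlam : ‖lam‖ ≤ 1) (hmu : ‖mu‖ ≤ 1) :
    (‖lam‖ = 1 →
      ThirdDieudonne.extremal1 r s lam ∈ ThirdDieudonne.Prescribed r s lam mu ∧
      ∀ f ∈ ThirdDieudonne.Prescribed r s lam mu,
        iteratedDeriv 3 f (r : ℂ) = ThirdDieudonne.c0 r s lam mu ∧
        Set.EqOn f (ThirdDieudonne.extremal1 r s lam) (Metric.ball 0 1)) ∧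
    (‖lam‖ < 1 → ‖mu‖ = 1 →
      ThirdDieudonne.extremal2 r s lam mu ∈ ThirdDieudonne.Prescribed r s lam mu ∧
      ∀ f ∈ ThirdDieudonne.Prescribed r s lam mu,
        iteratedDeriv 3 f (r : ℂ) = ThirdDieudonne.c0 r s lam mu ∧
        Set.EqOn f (ThirdDieudonne.extremal2 r s lam mu) (Metric.ball 0 1)) ∧
    (‖lam‖ < 1 → ‖mu‖ < 1 →
      (fun f : ℂ → ℂ => iteratedDeriv 3 f (r : ℂ)) '' ThirdDieudonne.Prescribed r s lam mu =
        Metric.closedBall (ThirdDieudonne.c0 r s lam mu) (ThirdDieudonne.rho0 r s lam mu) ∧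
      (∀ θ : ℝ,
        ThirdDieudonne.extremal3 r s lam mu θ ∈ ThirdDieudonne.Prescribed r s lam mu) ∧
      ∀ f ∈ ThirdDieudonne.Prescribed r s lam mu,
        (iteratedDeriv 3 f (r : ℂ) ∈
            Metric.sphere (ThirdDieudonne.c0 r s lam mu) (ThirdDieudonne.rho0 r s lam mu) ↔
          ∃ θ : ℝ,
            Set.EqOn f (ThirdDieudonne.extremal3 r s lam mu θ) (Metric.ball 0 1))) :=
  ⟨fun h => ⟨ThirdDieudonne.extremal1_mem_prescribed hs hsr hr h mu,
      fun _ hf => ThirdDieudonne.eqOn_extremal1 hs hsr hr h hf⟩,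
    fun h h' => ⟨ThirdDieudonne.extremal2_mem_prescribed hs hsr hr h h',
      fun _ hf => ThirdDieudonne.eqOn_extremal2 hs hsr hr h h' hf⟩,
    fun h h' => ⟨ThirdDieudonne.image_iteratedDeriv_three hs hsr hr h h',
      ThirdDieudonne.extremal3_mem_prescribed hs hsr hr h h',
      fun _ hf => ThirdDieudonne.iteratedDeriv_three_mem_sphere_iff hs hsr hr h h' hf⟩⟩
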